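/- Let $G$ be a finite graph, possibly with loops and parallel edges, that has $n$ vertices and at least one edge. Suppose that $G$ is 3-edge-connected, i.e. $G$ has a vertex and at least three edges leave every nonempty proper subset of $V(G)$. Fix any orientation of the edges of $G$. A nowhere-zero $\mathbb{Z}_2\times\mathbb{Z}_3$-flow on $G$ is a map $\phi\colon E(G)\to(\mathbb{Z}_2\times\mathbb{Z}_3)\setminus\{0\}$ such that $\sum_{e\in\delta^+(v)}\phi(e)=\sum_{e\in\delta^-(v)}\phi(e)$ for every vertex $v$, where $\delta^+(v)$ and $\delta^-(v)$ are the sets of edges directed away from and towards $v$ (a loop at $v$ belongs to both). Then $G$ has at least $2^{n/7}$ nowhere-zero $\mathbb{Z}_2\times\mathbb{Z}_3$-flows. -/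

import Mathlib

namespace Graph

/-- `G.cut X` is the set of edges leaving `X`, that is, the edges of `G` with one end in `X`
and the other end a vertex of `G` outside `X`. -/
def cut {α β : Type*} (G : Graph α β) (X : Set α) : Set β :=
  {e | ∃ x ∈ X, ∃ y ∈ G.vertexSet \ X, G.IsLink e x y}

/-- A graph is `k`-edge-connected if it has a vertex and at least `k` edges leave every
nonempty proper subset of its vertex set. -/
def IsEdgeConnected {α β : Type*} (G : Graph α β) (k : ℕ) : Prop :=
  G.vertexSet.Nonempty ∧
    ∀ X : Set α, X ⊂ G.vertexSet → X.Nonempty → (k : ℕ∞) ≤ (G.cut X).encard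

/-- An orientation of the edges of a multigraph: each edge is directed from one of its ends
(its tail) to the other (its head). For a loop both are the unique end of the loop. -/
structure Orientation {α β : Type*} (G : Graph α β) where
  tail : G.edgeSet → α
  head : G.edgeSet → α
  isLink : ∀ e : G.edgeSet, G.IsLink e (tail e) (head e)

theorem nonempty_orientation {α β : Type*} (G : Graph α β) : Nonempty G.Orientation := by
  choose t h hl using fun e : G.edgeSet => Graph.exists_isLink_of_mem_edgeSet e.2
  exact ⟨⟨t, h, hl⟩⟩

/-- Edges directed away from `v`. -/
def Orientation.outEdges {α β : Type*} {G : Graph α β} (D : G.Orientation) (v : α) :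
    Set G.edgeSet := {e | D.tail e = v}

/-- Edges directed towards `v`. -/
def Orientation.inEdges {α β : Type*} {G : Graph α β} (D : G.Orientation) (v : α) :
    Set G.edgeSet := {e | D.head e = v}

/-- `φ` satisfies Kirchhoff's law at every vertex. -/
def Orientation.IsFlow {α β Γ : Type*} [AddCommGroup Γ] {G : Graph α β} (D : G.Orientation)
    (φ : G.edgeSet → Γ) : Prop :=
  ∀ v ∈ G.vertexSet, ∑ᶠ e ∈ D.outEdges v, φ e = ∑ᶠ e ∈ D.inEdges v, φ e

/-- The set of nowhere-zero `Γ`-flows with respect to the orientation `D`. -/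
def Orientation.nowhereZeroFlows {α β : Type*} {G : Graph α β} (D : G.Orientation)
    (Γ : Type*) [AddCommGroup Γ] : Set (G.edgeSet → Γ) :=
  {φ | D.IsFlow φ ∧ ∀ e, φ e ≠ 0}

end Graph

/-!
A nowhere-zero `ZMod 2 × ZMod 3`-flow is a `ZMod 2`-flow `ψ` together with a `ZMod 3`-flow `φ` such
that no edge is a zero of both. One such pair yields many.

Write `Z` for the support of `ψ`. Each edge of `Z` lies on a cycle of `Z`, so after adding a uniformly
random `ZMod 3`-flow on `Z` to `φ` its value on each edge of `Z` is uniform, and for some choice `φ`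
vanishes on at most a third of `Z` (`exists_flow_few_zeros`); off `Z` it is still nonzero. Let `Y` be
the support of this `φ`. Adding to `ψ` any element of the `ZMod 2`-cycle space of `Y` gives another
pair, and that space has dimension at least `|Y| - n` (`two_pow_le_card_flows`). Here
`6 |Y| ≥ 6 |E| - 2 |Z| = ∑ v, (2 z v + 3 w v)`, where `z v` and `w v` are the degrees of `v` in `Z` and
off `Z`. As `z v` is even and `z v + w v ≥ 3`, each summand is at least `7` when there are two or more
vertices (`seven_mul_card_le`), so `|Y| - n ≥ n / 6`. With one vertex all edges are loops, and two
constant flows suffice.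

The first pair comes from Seymour's 6-flow theorem (`exists_flow_pair`). A vertex set `U` is grown
together with a `ZMod 2`-flow `ψ` on the graph it induces, so that a `ZMod 3`-flow on that graph can
avoid any prescribed value on each edge outside the support of `ψ` (`Avoidable`). If `U` is not
everything, take a leaf `K` in the tree of two-edge-connected components of the rest
(`exists_leaf_component`). By 3-edge-connectivity two edges join `K` to `U`. Two edge-disjoint paths
in `K` between their ends, obtained by augmenting a unit-capacity flow, form an even subgraph, and its
component containing these ends can be added to `U` (`Avoidable.union`). To allow arbitrary forbidden
values, and not only `0`, is what makes the induction work.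
-/

/-! ### Chains and boundaries -/

section Chains

variable {V E : Type*} [Fintype E] [DecidableEq V] {R : Type*} [CommRing R]

/-- The boundary of an `R`-chain on the digraph with tails `t` and heads `h`: its value at `v` is
the outflow minus the inflow, so that flows are the chains with boundary zero. A loop contributes
nothing. -/
def boundary (t h : E → V) : (E → R) →ₗ[R] (V → R) where
  toFun φ v := ∑ e, φ e * ((if t e = v then 1 else 0) - (if h e = v then 1 else 0))
  map_add' φ ψ := by
    funext v
    simp only [Pi.add_apply, add_mul, Finset.sum_add_distrib]
  map_smul' c φ := by
    funext v
    simp only [Pi.smul_apply, smul_eq_mul, RingHom.id_apply, Finset.mul_sum, mul_assoc]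

variable (t h : E → V)

theorem boundary_apply (φ : E → R) (v : V) :
    boundary t h φ v = ∑ e, φ e * ((if t e = v then 1 else 0) - (if h e = v then 1 else 0)) := rfl

theorem boundary_single [DecidableEq E] (e : E) (c : R) :
    boundary t h (Pi.single e c) = Pi.single (t e) c - Pi.single (h e) c := by
  funext v
  rw [boundary_apply, Finset.sum_eq_single e]
  · simp only [Pi.single_eq_same, Pi.sub_apply, Pi.single_apply, eq_comm (a := v), mul_sub,
      mul_ite, mul_one, mul_zero]
  · intro b _ hb
    simp [hb]
  · simp

/-- The net flow of a chain out of a vertex set. -/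
theorem sum_boundary (φ : E → R) (S : Finset V) :
    ∑ v ∈ S, boundary t h φ v =
      ∑ e, φ e * ((if t e ∈ S then 1 else 0) - (if h e ∈ S then 1 else 0)) := by
  simp only [boundary_apply]
  rw [Finset.sum_comm]
  refine Finset.sum_congr rfl fun e _ => ?_
  rw [← Finset.mul_sum, Finset.sum_sub_distrib]
  simp

/-- Restricting a chain to the edges inside a set that its support does not leave keeps the
boundary inside the set and kills it outside. -/
theorem boundary_restrict (φ : E → R) (S : Finset V) (hS : ∀ e, φ e ≠ 0 → (t e ∈ S ↔ h e ∈ S))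
    (v : V) :
    boundary t h (fun e => if t e ∈ S ∧ h e ∈ S then φ e else 0) v =
      if v ∈ S then boundary t h φ v else 0 := by
  simp only [boundary_apply]
  split_ifs with hv
  · refine Finset.sum_congr rfl fun e _ => ?_
    by_cases h0 : φ e = 0
    · simp [h0]
    have := hS e h0
    by_cases h1 : t e = v <;> by_cases h2 : h e = v <;> simp_all
  · refine Finset.sum_eq_zero fun e _ => ?_
    split_ifs <;> simp_all

/-- An edge joining `a` and `b`, in either direction, carries a unit chain from `a` to `b`. -/
theorem exists_chain_edge [Nontrivial R] {e : E} {a b : V}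
    (hab : (t e = a ∧ h e = b) ∨ (t e = b ∧ h e = a)) :
    ∃ p : E → R, p e ≠ 0 ∧ (∀ g, p g ≠ 0 → g = e) ∧
      boundary t h p = Pi.single a 1 - Pi.single b 1 := by
  classical
  rcases hab with ⟨rfl, rfl⟩ | ⟨rfl, rfl⟩
  · refine ⟨Pi.single e 1, by simp, fun g hg => ?_, boundary_single t h e 1⟩
    by_contra hne
    simp [hne] at hg
  · refine ⟨-Pi.single e 1, by simp, fun g hg => ?_, ?_⟩
    · by_contra hne
      simp [hne] at hg
    · rw [map_neg, boundary_single, neg_sub]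

end Chains

/-! ### Two edge-disjoint paths -/

section Augment

variable {V E : Type*} [Fintype E] [DecidableEq V] (t h : E → V)

/-- One augmentation step of the max-flow algorithm with unit capacities inside `K`: a flow of
value less than two from `x` to `y` can be increased by one, since `x` and `y` are not separated
by fewer than two edges. -/
theorem exists_augmentation (K : Finset V)
    (hK : ∀ S ⊆ K, S.Nonempty → S ≠ K →
      2 ≤ (Finset.univ.filter fun e => (t e ∈ S ∧ h e ∈ K \ S) ∨ (t e ∈ K \ S ∧ h e ∈ S)).card)
    {x y : V} (hx : x ∈ K) (hy : y ∈ K) (f : E → ℤ) (c : ℤ) (hc : c < 2)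
    (hf : ∀ e, |f e| ≤ 1) (hfK : ∀ e, f e ≠ 0 → t e ∈ K ∧ h e ∈ K)
    (hb : boundary t h f = c • (Pi.single x 1 - Pi.single y 1)) :
    ∃ f' : E → ℤ, (∀ e, |f' e| ≤ 1) ∧ (∀ e, f' e ≠ 0 → t e ∈ K ∧ h e ∈ K) ∧
      boundary t h f' = (c + 1) • (Pi.single x 1 - Pi.single y 1) := by
  classical
  -- `good S`: each vertex of `S` is reached from `x` by a residual path inside `S`.
  let good : Finset V → Prop := fun S => x ∈ S ∧ ∀ v ∈ S, ∃ p : E → ℤ,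
    (∀ e, p e ≠ 0 → t e ∈ S ∧ h e ∈ S) ∧ boundary t h p = Pi.single x 1 - Pi.single v 1 ∧
      ∀ e, |f e + p e| ≤ 1
  have hgood : good {x} := by
    refine ⟨by simp, fun v hv => ⟨0, by simp, ?_, by simpa using hf⟩⟩
    rw [Finset.mem_singleton.1 hv]
    simp
  obtain ⟨S, hS, hmax⟩ := Finset.exists_max_image (K.powerset.filter good) Finset.card
    ⟨{x}, by simp [hx, hgood]⟩
  simp only [Finset.mem_filter, Finset.mem_powerset] at hS hmax
  obtain ⟨hSK, hxS, hSp⟩ := hS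
  -- A residual edge leaving `S` would enlarge `S`.
  have hext : ∀ (e : E) (u w : V) (s : ℤ), u ∈ S → w ∈ K → w ∉ S →
      (s = 1 ∧ t e = u ∧ h e = w) ∨ (s = -1 ∧ t e = w ∧ h e = u) → ¬ |f e + s| ≤ 1 := by
    intro e u w s hu hw hwS hs hfs
    have hins : good (insert w S) := by
      refine ⟨Finset.mem_insert_of_mem hxS, fun v hv => ?_⟩
      rcases Finset.mem_insert.1 hv with rfl | hv
      · obtain ⟨p, hp1, hp2, hp3⟩ := hSp u hu
        have hpe : p e = 0 := by
          by_contra hne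
          have := hp1 e hne
          rcases hs with ⟨_, rfl, rfl⟩ | ⟨_, rfl, rfl⟩
          · exact hwS this.2
          · exact hwS this.1
        refine ⟨p + Pi.single e s, fun g hg => ?_, ?_, fun g => ?_⟩
        · by_cases hge : g = e
          · subst hge
            rcases hs with ⟨_, rfl, rfl⟩ | ⟨_, rfl, rfl⟩ <;> simp [hu]
          · have := hp1 g (by simpa [hge] using hg)
            exact ⟨Finset.mem_insert_of_mem this.1, Finset.mem_insert_of_mem this.2⟩
        · rw [map_add, hp2, boundary_single]
          rcases hs with ⟨rfl, rfl, rfl⟩ | ⟨rfl, rfl, rfl⟩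
          · abel
          · rw [Pi.single_neg, Pi.single_neg]
            abel
        · by_cases hge : g = e
          · subst hge
            simpa [hpe] using hfs
          · simpa [hge] using hp3 g
      · obtain ⟨p, hp1, hp2, hp3⟩ := hSp v hv
        exact ⟨p, fun e he => ⟨Finset.mem_insert_of_mem (hp1 e he).1,
          Finset.mem_insert_of_mem (hp1 e he).2⟩, hp2, hp3⟩
    have := hmax _ ⟨Finset.insert_subset hw hSK, hins⟩
    rw [Finset.card_insert_of_notMem hwS] at this
    omega
  by_cases hyS : y ∈ S
  · obtain ⟨p, hp1, hp2, hp3⟩ := hSp y hyS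
    refine ⟨f + p, hp3, fun e he => ?_, ?_⟩
    · by_cases h0 : p e = 0
      · exact hfK e (by simpa [h0] using he)
      · exact ⟨hSK (hp1 e h0).1, hSK (hp1 e h0).2⟩
    · rw [map_add, hb, hp2, add_smul, one_smul]
  exfalso
  have hne : S ≠ K := by
    rintro rfl
    exact hyS hy
  -- All edges leaving `S` are saturated, so their number is the value `c` of the flow.
  have hcut := hK S hSK ⟨x, hxS⟩ hne
  have hflux := sum_boundary t h f S
  have hl : ∑ v ∈ S, boundary t h f v = c := by
    rw [hb]
    simp only [Pi.smul_apply, Pi.sub_apply, Pi.single_apply, smul_eq_mul]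
    rw [← Finset.mul_sum, Finset.sum_sub_distrib]
    simp [hxS, hyS]
  have hr : ∑ e, f e * ((if t e ∈ S then 1 else 0) - (if h e ∈ S then 1 else 0)) =
      ((Finset.univ.filter fun e =>
        (t e ∈ S ∧ h e ∈ K \ S) ∨ (t e ∈ K \ S ∧ h e ∈ S)).card : ℤ) := by
    rw [Finset.card_filter, Nat.cast_sum]
    refine Finset.sum_congr rfl fun e _ => ?_
    have he := abs_le.1 (hf e)
    by_cases ht : t e ∈ S <;> by_cases hh : h e ∈ S
    · simp [ht, hh]
    · by_cases hhK : h e ∈ K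
      · have := hext e _ _ 1 ht hhK hh (Or.inl ⟨rfl, rfl, rfl⟩)
        rw [abs_le] at this
        have : f e = 1 := by omega
        simp [ht, hh, hhK, this]
      · have : f e = 0 := by
          by_contra h0
          exact hhK (hfK e h0).2
        simp [ht, hh, hhK, this]
    · by_cases htK : t e ∈ K
      · have := hext e _ _ (-1) hh htK ht (Or.inr ⟨rfl, rfl, rfl⟩)
        rw [abs_le] at this
        have : f e = -1 := by omega
        simp [ht, hh, htK, this]
      · have : f e = 0 := by
          by_contra h0
          exact htK (hfK e h0).1
        simp [ht, hh, htK, this]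
    · simp [ht, hh]
  rw [hl, hr] at hflux
  omega

/-- Inside a vertex set that no single edge separates, any two vertices lie in a common connected
even subgraph: a component of the union of two edge-disjoint paths between them. Connectedness is expressed by
`ZMod 3`-chains. -/
theorem exists_even_subgraph (K : Finset V)
    (hK : ∀ S ⊆ K, S.Nonempty → S ≠ K →
      2 ≤ (Finset.univ.filter fun e => (t e ∈ S ∧ h e ∈ K \ S) ∨ (t e ∈ K \ S ∧ h e ∈ S)).card)
    {x y : V} (hx : x ∈ K) (hy : y ∈ K) :
    ∃ (S : Finset V) (ψ : E → ZMod 2), S ⊆ K ∧ x ∈ S ∧ y ∈ S ∧ boundary t h ψ = 0 ∧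
      (∀ e, ψ e ≠ 0 → t e ∈ S ∧ h e ∈ S) ∧
      ∀ v ∈ S, ∃ p : E → ZMod 3, (∀ e, p e ≠ 0 → ψ e ≠ 0) ∧
        boundary t h p = Pi.single x 1 - Pi.single v 1 := by
  classical
  obtain ⟨f, hf, hfK, hb⟩ : ∃ f : E → ℤ, (∀ e, |f e| ≤ 1) ∧
      (∀ e, f e ≠ 0 → t e ∈ K ∧ h e ∈ K) ∧
      boundary t h f = (2 : ℤ) • (Pi.single x 1 - Pi.single y 1) := by
    obtain ⟨f, h1, h2, h3⟩ := exists_augmentation t h K hK hx hy 0 0 (by norm_num)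
      (by simp) (by simp) (by simp)
    exact exists_augmentation t h K hK hx hy f _ (by norm_num) h1 h2 h3
  have hcast : ∀ {A : Type} [CommRing A] (v : V), boundary t h (fun e => (f e : A)) v =
      2 * ((if v = x then 1 else 0) - (if v = y then 1 else 0)) := by
    intro A _ v
    have := congrArg (Int.cast : ℤ → A) (congrFun hb v)
    rw [boundary_apply] at this ⊢
    simpa [Pi.single_apply] using this
  let S : Finset V := K.filter fun v => ∃ p : E → ZMod 3, (∀ e, p e ≠ 0 → f e ≠ 0) ∧
    boundary t h p = Pi.single x 1 - Pi.single v 1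
  have hclosed : ∀ e, f e ≠ 0 → (t e ∈ S ↔ h e ∈ S) := by
    intro e he
    have hKe := hfK e he
    simp only [S, Finset.mem_filter, hKe.1, hKe.2, true_and]
    constructor
    · rintro ⟨p, hp, hpb⟩
      refine ⟨p + Pi.single e 1, fun g hg => ?_, ?_⟩
      · by_cases hge : g = e
        · rwa [hge]
        · exact hp g (by simpa [hge] using hg)
      · rw [map_add, hpb, boundary_single]
        abel
    · rintro ⟨p, hp, hpb⟩
      refine ⟨p - Pi.single e 1, fun g hg => ?_, ?_⟩
      · by_cases hge : g = e
        · rwa [hge]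
        · exact hp g (by simpa [hge] using hg)
      · rw [map_sub, hpb, boundary_single]
        abel
  have hf2 : ∀ e, f e ≠ 0 → (f e : ZMod 2) ≠ 0 := by
    intro e he
    have := abs_le.1 (hf e)
    have : f e = 1 ∨ f e = -1 := by omega
    rcases this with h1 | h1 <;> rw [h1] <;> decide
  have hxS : x ∈ S := by
    refine Finset.mem_filter.2 ⟨hx, 0, by simp, by simp⟩
  refine ⟨S, fun e => if t e ∈ S ∧ h e ∈ S then (f e : ZMod 2) else 0, Finset.filter_subset _ _,
    hxS, ?_, ?_, ?_, ?_⟩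
  · -- Modulo 3, twice the integer chain is a unit chain from `x` to `y`.
    refine Finset.mem_filter.2 ⟨hy, fun e => 2 * (f e : ZMod 3), fun e he h0 => ?_, ?_⟩
    · simp [h0] at he
    · have h2 : (fun e => 2 * (f e : ZMod 3)) = (2 : ZMod 3) • fun e => (f e : ZMod 3) := rfl
      funext v
      rw [h2, map_smul, Pi.smul_apply, hcast, smul_eq_mul, ← mul_assoc,
        show (2 : ZMod 3) * 2 = 1 from rfl, one_mul]
      simp [Pi.single_apply]
  · funext v
    rw [boundary_restrict t h (fun e => (f e : ZMod 2)) S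
      (fun e he => hclosed e fun h0 => he (by simp [h0])), hcast,
      show (2 : ZMod 2) = 0 from rfl, zero_mul, ite_self, Pi.zero_apply]
  · intro e he
    by_contra hne
    simp [hne] at he
  · intro v hv
    obtain ⟨-, p, hp, hpb⟩ := Finset.mem_filter.1 hv
    refine ⟨fun e => if t e ∈ S ∧ h e ∈ S then p e else 0, fun e he => ?_, ?_⟩
    · dsimp only at he ⊢
      split_ifs at he with hS
      · simpa [hS] using hf2 e (hp e he)
      · exact absurd rfl he
    · funext w
      rw [boundary_restrict t h p S (fun e he => hclosed e (hp e he)), hpb]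
      split_ifs with hw
      · rfl
      · have h1 : w ≠ x := fun h => hw (h ▸ hxS)
        have h2 : w ≠ v := fun h => hw (h ▸ hv)
        simp [h1, h2]

end Augment

/-! ### Existence of a nowhere-zero flow -/

section Existence

variable {V E : Type*} [Fintype E] [DecidableEq V] (t h : E → V)

/-- The complement `W` of a vertex set contains a nonempty set `K` that at most one edge joins to
`W \ K` and that no single edge of `K` separates: a leaf in the tree of two-edge-connected
components. In a 3-edge-connected graph at least two edges join `K` to the outside of `W`. -/
theorem exists_leaf_component [Fintype V]
    (hG : ∀ X : Finset V, X.Nonempty → X ≠ Finset.univ →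
      3 ≤ (Finset.univ.filter fun e => (t e ∈ X ∧ h e ∉ X) ∨ (t e ∉ X ∧ h e ∈ X)).card)
    (U : Finset V) (hU : U.Nonempty) (hU' : U ≠ Finset.univ) :
    ∃ K : Finset V, Disjoint U K ∧
      (∀ S ⊆ K, S.Nonempty → S ≠ K → 2 ≤ (Finset.univ.filter fun e =>
        (t e ∈ S ∧ h e ∈ K \ S) ∨ (t e ∈ K \ S ∧ h e ∈ S)).card) ∧
      1 < (Finset.univ.filter fun e => (t e ∈ U ∧ h e ∈ K) ∨ (t e ∈ K ∧ h e ∈ U)).card := by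
  classical
  let cut : Finset V → Finset V → Finset E := fun W S => Finset.univ.filter fun e =>
    (t e ∈ S ∧ h e ∈ W \ S) ∨ (t e ∈ W \ S ∧ h e ∈ S)
  obtain ⟨K, hK, hmin⟩ := Finset.exists_min_image
    ((Uᶜ).powerset.filter fun K => K.Nonempty ∧ (cut Uᶜ K).card ≤ 1) Finset.card
    ⟨Uᶜ, by
      simp only [Finset.mem_filter, Finset.mem_powerset, subset_refl, true_and]
      exact ⟨by simpa [Finset.nonempty_iff_ne_empty] using hU', by simp [cut]⟩⟩
  simp only [Finset.mem_filter, Finset.mem_powerset] at hK hmin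
  obtain ⟨hKU, hKne, hK1⟩ := hK
  refine ⟨K, ?_, ?_, ?_⟩
  · exact Finset.disjoint_left.2 fun v hv hvK => Finset.mem_compl.1 (hKU hvK) hv
  · intro S hSK hSne hne
    have hlt : ∀ S ⊆ K, S.Nonempty → S ≠ K → 2 ≤ (cut Uᶜ S).card := by
      intro S hSK hSne hne
      by_contra hcon
      have := hmin S ⟨hSK.trans hKU, hSne, by omega⟩
      have := Finset.card_lt_card (Finset.ssubset_iff_subset_ne.2 ⟨hSK, hne⟩)
      omega
    have h1 := hlt S hSK hSne hne
    have h2 := hlt (K \ S) Finset.sdiff_subset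
      (Finset.sdiff_nonempty.2 fun hKS => hne (hSK.antisymm hKS)) (by
        intro heq
        obtain ⟨v, hv⟩ := hSne
        have := heq ▸ hSK hv
        exact (Finset.mem_sdiff.1 this).2 hv)
    have h3 : (cut Uᶜ S).card + (cut Uᶜ (K \ S)).card ≤
        2 * (cut K S).card + (cut Uᶜ K).card := by
      simp only [cut, Finset.card_filter, Finset.mul_sum]
      rw [← Finset.sum_add_distrib, ← Finset.sum_add_distrib]
      refine Finset.sum_le_sum fun e _ => ?_
      have loc : ∀ v, (v ∈ S ∧ v ∈ K ∧ v ∉ U) ∨ (v ∉ S ∧ v ∈ K ∧ v ∉ U) ∨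
          (v ∉ S ∧ v ∉ K ∧ v ∉ U) ∨ (v ∉ S ∧ v ∉ K ∧ v ∈ U) := by
        intro v
        have h1 := @hSK v
        have h2 := @hKU v
        rw [Finset.mem_compl] at h2
        tauto
      rcases loc (t e) with ⟨a1, a2, a3⟩ | ⟨a1, a2, a3⟩ | ⟨a1, a2, a3⟩ | ⟨a1, a2, a3⟩ <;>
        rcases loc (h e) with ⟨b1, b2, b3⟩ | ⟨b1, b2, b3⟩ | ⟨b1, b2, b3⟩ | ⟨b1, b2, b3⟩ <;>
        simp [a1, a2, a3, b1, b2, b3]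
    change 2 ≤ (cut K S).card
    omega
  · have h3 := hG K hKne (by
      rintro rfl
      obtain ⟨v, hv⟩ := hU
      exact Finset.mem_compl.1 (hKU (Finset.mem_univ v)) hv)
    have h4 := Finset.card_le_card (s := Finset.univ.filter fun e =>
        (t e ∈ K ∧ h e ∉ K) ∨ (t e ∉ K ∧ h e ∈ K))
      (t := cut Uᶜ K ∪ Finset.univ.filter fun e => (t e ∈ U ∧ h e ∈ K) ∨ (t e ∈ K ∧ h e ∈ U))
      (by
        intro e
        simp only [cut, Finset.mem_union, Finset.mem_filter, Finset.mem_univ, true_and,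
          Finset.mem_sdiff, Finset.mem_compl]
        tauto)
    have h5 := h4.trans (Finset.card_union_le _ _)
    omega

/-- `U` is spanned by a graph on which every list of forbidden values can be avoided by a
`ZMod 3`-flow, except on the support of the `ZMod 2`-flow `ψ`. The flows and the chains that
witness connectedness live on the edges with both ends in `U`. -/
structure Avoidable (U : Finset V) (ψ : E → ZMod 2) : Prop where
  boundary_eq : boundary t h ψ = 0
  support : ∀ e, ψ e ≠ 0 → t e ∈ U ∧ h e ∈ U
  connected : ∀ a ∈ U, ∀ b ∈ U, ∃ p : E → ZMod 3, (∀ e, p e ≠ 0 → t e ∈ U ∧ h e ∈ U) ∧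
    boundary t h p = Pi.single a 1 - Pi.single b 1
  avoid : ∀ g : E → ZMod 3, ∃ φ : E → ZMod 3, boundary t h φ = 0 ∧
    (∀ e, φ e ≠ 0 → t e ∈ U ∧ h e ∈ U) ∧ ∀ e, t e ∈ U → h e ∈ U → ψ e = 0 → φ e ≠ g e

theorem avoidable_singleton (v : V) : Avoidable t h {v} 0 where
  boundary_eq := map_zero _
  support := by simp
  connected a ha b hb := by
    rw [Finset.mem_singleton.1 ha, Finset.mem_singleton.1 hb]
    exact ⟨0, by simp, by simp⟩
  avoid g := by
    refine ⟨fun e => if t e ∈ ({v} : Finset V) ∧ h e ∈ ({v} : Finset V) then g e + 1 else 0,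
      ?_, ?_, ?_⟩
    · funext w
      rw [boundary_apply]
      refine Finset.sum_eq_zero fun e _ => ?_
      split_ifs <;> simp_all
    · intro e he
      by_contra hne
      exact he (if_neg hne)
    · intro e h1 h2 _
      simp [h1, h2]

/-- Of the three multiples of a flow, at most two hit a forbidden value on one of two edges. -/
theorem exists_mul_avoiding : ∀ a b c d : ZMod 3, c ≠ 0 → d ≠ 0 →
    ∃ k : ZMod 3, a + k * c ≠ 0 ∧ b + k * d ≠ 0 := by
  decide

/-- Two edges `e₁`, `e₂` from `U` to a connected even subgraph outside `U` allow that subgraph to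
be added to `U`. The values are chosen from the outside in: first on the new edges other than
`e₁` and `e₂`, each of which closes a cycle; then on `e₁` and `e₂`, which lie on one common cycle;
and the list that remains to be avoided inside `U` is corrected accordingly. -/
theorem Avoidable.union {U S : Finset V} {ψ ψ₁ : E → ZMod 2} (hU : Avoidable t h U ψ)
    (hUS : Disjoint U S) (hψb : boundary t h ψ₁ = 0)
    (hψS : ∀ e, ψ₁ e ≠ 0 → t e ∈ S ∧ h e ∈ S) {e₁ e₂ : E} (hne : e₁ ≠ e₂)
    {u₁ x₁ u₂ x₂ : V} (hu₁ : u₁ ∈ U) (hx₁ : x₁ ∈ S) (hu₂ : u₂ ∈ U) (hx₂ : x₂ ∈ S)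
    (he₁ : (t e₁ = u₁ ∧ h e₁ = x₁) ∨ (t e₁ = x₁ ∧ h e₁ = u₁))
    (he₂ : (t e₂ = u₂ ∧ h e₂ = x₂) ∨ (t e₂ = x₂ ∧ h e₂ = u₂))
    (hS : ∀ v ∈ S, ∃ p : E → ZMod 3, (∀ e, p e ≠ 0 → ψ₁ e ≠ 0) ∧
      boundary t h p = Pi.single x₁ 1 - Pi.single v 1) :
    Avoidable t h (U ∪ S) (ψ + ψ₁) := by
  classical
  have hdisj : ∀ v, v ∈ U → v ∉ S := fun _ hv => Finset.disjoint_left.1 hUS hv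
  have hψU : ∀ e, ψ₁ e ≠ 0 → ¬ (t e ∈ U ∧ h e ∈ U) := fun e he hc =>
    hdisj _ hc.1 (hψS e he).1
  have he₁U : ¬ (t e₁ ∈ U ∧ h e₁ ∈ U) := by
    rcases he₁ with ⟨h1, h2⟩ | ⟨h1, h2⟩ <;> rw [h1, h2] <;> intro hc
    · exact hdisj _ hc.2 hx₁
    · exact hdisj _ hc.1 hx₁
  have he₂U : ¬ (t e₂ ∈ U ∧ h e₂ ∈ U) := by
    rcases he₂ with ⟨h1, h2⟩ | ⟨h1, h2⟩ <;> rw [h1, h2] <;> intro hc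
    · exact hdisj _ hc.2 hx₂
    · exact hdisj _ hc.1 hx₂
  have he₁ψ : ψ₁ e₁ = 0 := by
    by_contra h0
    have := hψS _ h0
    rcases he₁ with ⟨h1, h2⟩ | ⟨h1, h2⟩ <;> rw [h1, h2] at this
    · exact hdisj _ hu₁ this.1
    · exact hdisj _ hu₁ this.2
  have he₂ψ : ψ₁ e₂ = 0 := by
    by_contra h0
    have := hψS _ h0
    rcases he₂ with ⟨h1, h2⟩ | ⟨h1, h2⟩ <;> rw [h1, h2] at this
    · exact hdisj _ hu₂ this.1
    · exact hdisj _ hu₂ this.2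
  have he₁US : t e₁ ∈ U ∪ S ∧ h e₁ ∈ U ∪ S := by
    rcases he₁ with ⟨h1, h2⟩ | ⟨h1, h2⟩ <;> rw [h1, h2] <;> simp [hu₁, hx₁]
  -- `core`: the edges that connect `U ∪ S`.
  let core : E → Prop := fun e => (t e ∈ U ∧ h e ∈ U) ∨ ψ₁ e ≠ 0 ∨ e = e₁
  have hcore : ∀ e, core e → t e ∈ U ∪ S ∧ h e ∈ U ∪ S := by
    rintro e (he | he | rfl)
    · exact ⟨Finset.mem_union_left _ he.1, Finset.mem_union_left _ he.2⟩
    · exact ⟨Finset.mem_union_right _ (hψS e he).1, Finset.mem_union_right _ (hψS e he).2⟩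
    · exact he₁US
  obtain ⟨c₁, hc₁, hc₁s, hc₁b⟩ := exists_chain_edge (R := ZMod 3) t h he₁
  obtain ⟨c₂, hc₂, hc₂s, hc₂b⟩ := exists_chain_edge (R := ZMod 3) t h he₂
  have hroot : ∀ v ∈ U ∪ S, ∃ p : E → ZMod 3, (∀ e, p e ≠ 0 → core e) ∧
      boundary t h p = Pi.single x₁ 1 - Pi.single v 1 := by
    intro v hv
    rcases Finset.mem_union.1 hv with hv | hv
    · obtain ⟨p, hp, hpb⟩ := hU.connected u₁ hu₁ v hv
      refine ⟨p - c₁, fun e he => ?_, ?_⟩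
      · by_cases h0 : p e = 0
        · exact Or.inr (Or.inr (hc₁s e (by simpa [h0] using he)))
        · exact Or.inl (hp e h0)
      · rw [map_sub, hpb, hc₁b]
        abel
    · obtain ⟨p, hp, hpb⟩ := hS v hv
      exact ⟨p, fun e he => Or.inr (Or.inl (hp e he)), hpb⟩
  have hconn : ∀ a ∈ U ∪ S, ∀ b ∈ U ∪ S, ∃ p : E → ZMod 3, (∀ e, p e ≠ 0 → core e) ∧
      boundary t h p = Pi.single a 1 - Pi.single b 1 := by
    intro a ha b hb
    obtain ⟨p, hp, hpb⟩ := hroot a ha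
    obtain ⟨q, hq, hqb⟩ := hroot b hb
    refine ⟨q - p, fun e he => ?_, ?_⟩
    · by_cases h0 : p e = 0
      · exact hq e (by simpa [h0] using he)
      · exact hp e h0
    · rw [map_sub, hpb, hqb]
      abel
  refine ⟨?_, ?_, ?_, ?_⟩
  · rw [map_add, hU.boundary_eq, hψb, add_zero]
  · intro e he
    by_cases h0 : ψ₁ e = 0
    · exact hcore e (Or.inl (hU.support e (by simpa [h0] using he)))
    · exact hcore e (Or.inr (Or.inl h0))
  · intro a ha b hb
    obtain ⟨p, hp, hpb⟩ := hconn a ha b hb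
    exact ⟨p, fun e he => hcore e (hp e he), hpb⟩
  intro g
  -- A flow with prescribed values on the edges outside `core`, except `e₂`.
  have hcyc : ∀ e, ∃ q : E → ZMod 3, boundary t h q = 0 ∧
      (∀ e', q e' ≠ 0 → t e' ∈ U ∪ S ∧ h e' ∈ U ∪ S) ∧
      ∀ e', ¬ core e' → q e' = if e' = e ∧ t e ∈ U ∪ S ∧ h e ∈ U ∪ S then 1 else 0 := by
    intro e
    by_cases he : t e ∈ U ∪ S ∧ h e ∈ U ∪ S
    · obtain ⟨p, hp, hpb⟩ := hconn _ he.2 _ he.1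
      refine ⟨p + Pi.single e 1, ?_, fun e' he' => ?_, fun e' he' => ?_⟩
      · rw [map_add, hpb, boundary_single]
        abel
      · by_cases hee : e' = e
        · rwa [hee]
        · exact hcore _ (hp e' (by simpa [hee] using he'))
      · have : p e' = 0 := by
          by_contra h0
          exact he' (hp e' h0)
        simp only [Pi.add_apply, this, zero_add, Pi.single_apply, he, and_true]
    · exact ⟨0, map_zero _, by simp, fun e' _ => by rw [if_neg fun hc => he hc.2, Pi.zero_apply]⟩
  choose q hqb hqs hq using hcyc
  obtain ⟨α, hαb, hαs, hα⟩ : ∃ α : E → ZMod 3, boundary t h α = 0 ∧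
      (∀ e, α e ≠ 0 → t e ∈ U ∪ S ∧ h e ∈ U ∪ S) ∧
      ∀ e, t e ∈ U ∪ S → h e ∈ U ∪ S → ¬ core e → e ≠ e₂ → α e = g e + 1 := by
    refine ⟨∑ e ∈ Finset.univ.filter (fun e => ¬ core e ∧ e ≠ e₂), (g e + 1) • q e, ?_, ?_, ?_⟩
    · rw [map_sum]
      exact Finset.sum_eq_zero fun e _ => by rw [map_smul, hqb, smul_zero]
    · intro e he
      rw [Finset.sum_apply] at he
      obtain ⟨e', -, he'⟩ := Finset.exists_ne_zero_of_sum_ne_zero he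
      exact hqs e' e (right_ne_zero_of_mul he')
    · intro e ht hh hec he2
      rw [Finset.sum_apply, Finset.sum_eq_single e]
      · simp [hq e e hec, ht, hh]
      · intro b _ hbe
        simp [hq b e hec, Ne.symm hbe]
      · intro hcon
        exact absurd (Finset.mem_filter.2 ⟨Finset.mem_univ _, hec, he2⟩) hcon
  -- The cycle through `e₁` and `e₂`.
  obtain ⟨p, hp, hpb⟩ := hU.connected u₁ hu₁ u₂ hu₂
  obtain ⟨r, hr, hrb⟩ := hS x₂ hx₂
  let C : E → ZMod 3 := p + c₂ - r - c₁
  have hCb : boundary t h C = 0 := by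
    simp only [C, map_sub, map_add, hpb, hrb, hc₁b, hc₂b]
    abel
  have hCs : ∀ e, C e ≠ 0 → core e ∨ e = e₂ := by
    intro e he
    by_contra hcon
    simp only [core, not_or] at hcon
    refine he ?_
    have z1 : p e = 0 := by
      by_contra h0
      exact hcon.1.1 (hp e h0)
    have z2 : r e = 0 := by
      by_contra h0
      exact hcon.1.2.1 (hr e h0)
    have z3 : c₁ e = 0 := by
      by_contra h0
      exact hcon.1.2.2 (hc₁s e h0)
    have z4 : c₂ e = 0 := by
      by_contra h0
      exact hcon.2 (hc₂s e h0)
    simp [C, z1, z2, z3, z4]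
  have hpr : ∀ e, ¬ (t e ∈ U ∧ h e ∈ U) → ψ₁ e = 0 → p e = 0 ∧ r e = 0 := by
    intro e h1 h2
    constructor
    · by_contra h0
      exact h1 (hp e h0)
    · by_contra h0
      exact hr e h0 h2
  have hC₁ : C e₁ ≠ 0 := by
    have := hpr e₁ he₁U he₁ψ
    have h2 : c₂ e₁ = 0 := by
      by_contra h0
      exact hne (hc₂s _ h0)
    simpa [C, this, h2] using hc₁
  have hC₂ : C e₂ ≠ 0 := by
    have := hpr e₂ he₂U he₂ψ
    have h2 : c₁ e₂ = 0 := by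
      by_contra h0
      exact hne (hc₁s _ h0).symm
    simpa [C, this, h2] using hc₂
  obtain ⟨k, hk₁, hk₂⟩ := exists_mul_avoiding (α e₁ - g e₁) (α e₂ - g e₂) _ _ hC₁ hC₂
  obtain ⟨φ, hφb, hφs, hφ⟩ := hU.avoid (g - (α + k • C))
  have he₂US : t e₂ ∈ U ∪ S ∧ h e₂ ∈ U ∪ S := by
    rcases he₂ with ⟨h1, h2⟩ | ⟨h1, h2⟩ <;> rw [h1, h2] <;> simp [hu₂, hx₂]
  refine ⟨α + k • C + φ, ?_, ?_, ?_⟩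
  · rw [map_add, map_add, map_smul, hαb, hCb, hφb]
    simp
  · intro e he
    by_contra hcon
    refine he ?_
    have z1 : α e = 0 := by
      by_contra h0
      exact hcon (hαs e h0)
    have z2 : C e = 0 := by
      by_contra h0
      rcases hCs e h0 with h1 | rfl
      · exact hcon (hcore e h1)
      · exact hcon he₂US
    have z3 : φ e = 0 := by
      by_contra h0
      exact hcon (hcore e (Or.inl (hφs e h0)))
    simp [z1, z2, z3]
  · intro e ht hh he0
    by_cases heU : t e ∈ U ∧ h e ∈ U
    · have z1 : ψ₁ e = 0 := by
        by_contra h0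
        exact hψU e h0 heU
      have := hφ e heU.1 heU.2 (by simpa [z1] using he0)
      intro hcon
      refine this ?_
      rw [Pi.sub_apply, ← hcon, Pi.add_apply (α + k • C)]
      ring
    · have zψ : ψ e = 0 := by
        by_contra h0
        exact heU (hU.support e h0)
      have zφ : φ e = 0 := by
        by_contra h0
        exact heU (hφs e h0)
      have zψ₁ : ψ₁ e = 0 := by simpa [zψ] using he0
      simp only [Pi.add_apply, Pi.smul_apply, smul_eq_mul, zφ, add_zero]
      intro hcon
      by_cases h1 : e = e₁
      · subst h1
        exact hk₁ (by rw [← hcon]; ring)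
      by_cases h2 : e = e₂
      · subst h2
        exact hk₂ (by rw [← hcon]; ring)
      have hnc : ¬ core e := by
        simp only [core, not_or]
        exact ⟨heU, by simpa using zψ₁, h1⟩
      have zC : C e = 0 := by
        by_contra h0
        rcases hCs e h0 with h3 | h3
        · exact hnc h3
        · exact h2 h3
      rw [hα e ht hh hnc h2, zC] at hcon
      simp at hcon

/-- Seymour's 6-flow theorem for 3-edge-connected graphs, in the form of a `ZMod 2`-flow and a
`ZMod 3`-flow that do not vanish simultaneously. -/
theorem exists_flow_pair [Fintype V] [Nonempty V]
    (hG : ∀ X : Finset V, X.Nonempty → X ≠ Finset.univ →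
      3 ≤ (Finset.univ.filter fun e => (t e ∈ X ∧ h e ∉ X) ∨ (t e ∉ X ∧ h e ∈ X)).card) :
    ∃ (ψ : E → ZMod 2) (φ : E → ZMod 3), boundary t h ψ = 0 ∧ boundary t h φ = 0 ∧
      ∀ e, ψ e = 0 → φ e ≠ 0 := by
  classical
  obtain ⟨v⟩ := ‹Nonempty V›
  obtain ⟨U, hU, hmax⟩ := Finset.exists_max_image
    (Finset.univ.filter fun U : Finset V => U.Nonempty ∧ ∃ ψ, Avoidable t h U ψ) Finset.card
    ⟨{v}, by simpa using ⟨0, avoidable_singleton t h v⟩⟩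
  simp only [Finset.mem_filter, Finset.mem_univ, true_and] at hU hmax
  obtain ⟨hUne, ψ, hψ⟩ := hU
  by_cases hUV : U = Finset.univ
  · obtain ⟨φ, h1, -, h2⟩ := hψ.avoid 0
    exact ⟨ψ, φ, hψ.boundary_eq, h1, fun e he => h2 e (by simp [hUV]) (by simp [hUV]) he⟩
  exfalso
  obtain ⟨K, hUK, hK, hcard⟩ := exists_leaf_component t h hG U hUne hUV
  obtain ⟨e₁, he₁, e₂, he₂, hne⟩ := Finset.one_lt_card.1 hcard
  have hends : ∀ e ∈ Finset.univ.filter (fun e => (t e ∈ U ∧ h e ∈ K) ∨ (t e ∈ K ∧ h e ∈ U)),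
      ∃ u ∈ U, ∃ x ∈ K, (t e = u ∧ h e = x) ∨ (t e = x ∧ h e = u) := by
    intro e he
    rcases (Finset.mem_filter.1 he).2 with h1 | h1
    · exact ⟨_, h1.1, _, h1.2, Or.inl ⟨rfl, rfl⟩⟩
    · exact ⟨_, h1.2, _, h1.1, Or.inr ⟨rfl, rfl⟩⟩
  obtain ⟨u₁, hu₁, x₁, hx₁, hl₁⟩ := hends e₁ he₁
  obtain ⟨u₂, hu₂, x₂, hx₂, hl₂⟩ := hends e₂ he₂
  obtain ⟨S, ψ₁, hSK, hx₁S, hx₂S, hψb, hψS, hS⟩ := exists_even_subgraph t h K hK hx₁ hx₂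
  have hUS : Disjoint U S := Finset.disjoint_of_subset_right hSK hUK
  have := hmax (U ∪ S) ⟨hUne.mono Finset.subset_union_left, _,
    hψ.union t h hUS hψb hψS hne hu₁ hx₁S hu₂ hx₂S hl₁ hl₂ hS⟩
  rw [Finset.card_union_of_disjoint hUS] at this
  have := Finset.card_pos.2 ⟨x₁, hx₁S⟩
  omega

end Existence

/-! ### Many flows from one -/

section Counting

variable {V E : Type*} [Fintype V] [Fintype E] [DecidableEq V] (t h : E → V)

/-- No edge in the support of a `ZMod 2`-flow is a bridge of that support, by parity, so each lies
in a cycle of it. -/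
theorem exists_flow_through (ψ : E → ZMod 2) (hψ : boundary t h ψ = 0) {e : E} (he : ψ e ≠ 0) :
    ∃ χ : E → ZMod 3, boundary t h χ = 0 ∧ (∀ g, χ g ≠ 0 → ψ g ≠ 0) ∧ χ e = 1 := by
  classical
  let S : Finset V := Finset.univ.filter fun v => ∃ p : E → ZMod 3,
    (∀ g, p g ≠ 0 → ψ g ≠ 0 ∧ g ≠ e) ∧ boundary t h p = Pi.single (h e) 1 - Pi.single v 1
  have hhS : h e ∈ S := Finset.mem_filter.2 ⟨Finset.mem_univ _, 0, by simp, by simp⟩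
  by_cases htS : t e ∈ S
  · obtain ⟨-, p, hp, hpb⟩ := Finset.mem_filter.1 htS
    refine ⟨p + Pi.single e 1, ?_, fun g hg => ?_, ?_⟩
    · rw [map_add, hpb, boundary_single]
      abel
    · by_cases hge : g = e
      · rwa [hge]
      · exact (hp g (by simpa [hge] using hg)).1
    · have : p e = 0 := by
        by_contra h0
        exact (hp e h0).2 rfl
      simp [this]
  exfalso
  have hclosed : ∀ g, ψ g ≠ 0 → g ≠ e → (t g ∈ S ↔ h g ∈ S) := by
    intro g hg hge
    simp only [S, Finset.mem_filter, Finset.mem_univ, true_and]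
    constructor
    · rintro ⟨p, hp, hpb⟩
      refine ⟨p + Pi.single g 1, fun g' hg' => ?_, ?_⟩
      · by_cases hgg : g' = g
        · exact hgg ▸ ⟨hg, hge⟩
        · exact hp g' (by simpa [hgg] using hg')
      · rw [map_add, hpb, boundary_single]
        abel
    · rintro ⟨p, hp, hpb⟩
      refine ⟨p - Pi.single g 1, fun g' hg' => ?_, ?_⟩
      · by_cases hgg : g' = g
        · exact hgg ▸ ⟨hg, hge⟩
        · exact hp g' (by simpa [hgg] using hg')
      · rw [map_sub, hpb, boundary_single]
        abel
  have hflux := sum_boundary t h ψ S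
  rw [hψ, Finset.sum_eq_single e] at hflux
  · simp [htS, hhS] at hflux
    exact he hflux.symm
  · intro g _ hge
    by_cases hg : ψ g = 0
    · simp [hg]
    · simp [hclosed g hg hge]
  · simp

/-- Adding a random `ZMod 3`-flow on the support of `ψ` makes the value on each edge of the
support uniform, so some choice vanishes on at most a third of these edges. -/
theorem exists_flow_few_zeros (ψ : E → ZMod 2) (hψ : boundary t h ψ = 0) (φ : E → ZMod 3)
    (hφ : boundary t h φ = 0) (hψφ : ∀ e, ψ e = 0 → φ e ≠ 0) :
    ∃ φ' : E → ZMod 3, boundary t h φ' = 0 ∧ (∀ e, ψ e = 0 → φ' e ≠ 0) ∧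
      3 * (Finset.univ.filter fun e => φ' e = 0).card ≤
        (Finset.univ.filter fun e => ψ e ≠ 0).card := by
  classical
  let L : Finset (E → ZMod 3) :=
    Finset.univ.filter fun φ' => boundary t h φ' = 0 ∧ ∀ e, ψ e = 0 → φ' e = φ e
  have hL : L.Nonempty := ⟨φ, by simp [L, hφ]⟩
  have hfib : ∀ e, ψ e ≠ 0 → 3 * (L.filter fun φ' => φ' e = 0).card = L.card := by
    intro e he
    obtain ⟨χ, hχ, hχs, hχe⟩ := exists_flow_through t h ψ hψ he
    have hadd : ∀ (c : ZMod 3), ∀ φ' ∈ L, φ' + c • χ ∈ L := by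
      intro c φ' hφ'
      simp only [L, Finset.mem_filter, Finset.mem_univ, true_and] at hφ' ⊢
      refine ⟨by rw [map_add, map_smul, hφ'.1, hχ]; simp, fun g hg => ?_⟩
      have : χ g = 0 := by
        by_contra h0
        exact hχs g h0 hg
      simp [this, hφ'.2 g hg]
    have hcard : ∀ c : ZMod 3,
        (L.filter fun φ' => φ' e = c).card = (L.filter fun φ' => φ' e = 0).card := by
      intro c
      refine Finset.card_nbij' (fun φ' => φ' + (-c) • χ) (fun φ' => φ' + c • χ) ?_ ?_ ?_ ?_
      · intro φ' hφ'
        obtain ⟨h1, h2⟩ := Finset.mem_filter.1 hφ'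
        exact Finset.mem_filter.2 ⟨hadd _ _ h1, by simp [h2, hχe]⟩
      · intro φ' hφ'
        obtain ⟨h1, h2⟩ := Finset.mem_filter.1 hφ'
        exact Finset.mem_filter.2 ⟨hadd _ _ h1, by simp [h2, hχe]⟩
      · intro φ' _
        simp
      · intro φ' _
        simp
    rw [Finset.card_eq_sum_card_fiberwise (s := L) (f := fun φ' : E → ZMod 3 => φ' e)
      (t := (Finset.univ : Finset (ZMod 3))) (fun _ _ => Finset.mem_coe.2 (Finset.mem_univ _)),
      Finset.sum_congr rfl fun c _ => hcard c, Finset.sum_const, Finset.card_univ, ZMod.card,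
      smul_eq_mul]
  have hzero : ∀ φ' ∈ L, (Finset.univ.filter fun e => φ' e = 0) =
      (Finset.univ.filter fun e => ψ e ≠ 0).filter fun e => φ' e = 0 := by
    intro φ' hφ'
    have hφ'' := (Finset.mem_filter.1 hφ').2.2
    ext e
    simp only [Finset.mem_filter, Finset.mem_univ, true_and]
    refine ⟨fun h0 => ⟨fun h1 => hψφ e h1 (hφ'' e h1 ▸ h0), h0⟩, fun h0 => h0.2⟩
  by_contra! hcon
  have hlt : ∑ φ' ∈ L, (Finset.univ.filter fun e => ψ e ≠ 0).card <
      ∑ φ' ∈ L, 3 * (Finset.univ.filter fun e => φ' e = 0).card := by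
    refine Finset.sum_lt_sum_of_nonempty hL fun φ' hφ' => ?_
    have h1 := (Finset.mem_filter.1 hφ').2
    exact hcon φ' h1.1 fun e he => by rw [h1.2 e he]; exact hψφ e he
  rw [Finset.sum_const, smul_eq_mul, ← Finset.mul_sum,
    Finset.sum_congr rfl fun φ' hφ' => congrArg Finset.card (hzero φ' hφ')] at hlt
  have hswap := Finset.sum_card_bipartiteAbove_eq_sum_card_bipartiteBelow (s := L)
    (t := Finset.univ.filter fun e => ψ e ≠ 0) (r := fun φ' e => φ' e = 0)
  simp only [Finset.bipartiteAbove, Finset.bipartiteBelow] at hswap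
  rw [hswap, Finset.mul_sum, Finset.sum_congr rfl fun e he => hfib e (Finset.mem_filter.1 he).2,
    Finset.sum_const, smul_eq_mul, mul_comm] at hlt
  exact lt_irrefl _ hlt

/-- Each vertex contributes `2z + 3w ≥ 7`, where `z` is its degree in the support of `ψ`, which is
even, and `w` its degree in the complement. -/
theorem seven_mul_card_le (ψ : E → ZMod 2) (hψ : boundary t h ψ = 0)
    (hdeg : ∀ v, 3 ≤ (Finset.univ.filter fun e =>
      (t e = v ∧ h e ≠ v) ∨ (t e ≠ v ∧ h e = v)).card) :
    7 * Fintype.card V + 2 * (Finset.univ.filter fun e => ψ e ≠ 0).card ≤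
      6 * Fintype.card E := by
  classical
  let z : V → ℕ := fun v => ∑ e,
    if ψ e ≠ 0 then (if t e = v then 1 else 0) + (if h e = v then 1 else 0) else 0
  let w : V → ℕ := fun v => ∑ e,
    if ψ e ≠ 0 then 0 else (if t e = v then 1 else 0) + (if h e = v then 1 else 0)
  have hv : ∀ v, 7 ≤ 2 * z v + 3 * w v := by
    intro v
    have h3 : 3 ≤ z v + w v := by
      refine (hdeg v).trans ?_
      rw [Finset.card_filter, ← Finset.sum_add_distrib]
      refine Finset.sum_le_sum fun e _ => ?_
      by_cases h1 : t e = v <;> by_cases h2 : h e = v <;> by_cases h3 : ψ e = 0 <;>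
        simp [h1, h2, h3]
    have h2 : Even (z v) := by
      rw [← ZMod.natCast_eq_zero_iff_even, ← Pi.zero_apply (M := fun _ : V => ZMod 2) v, ← hψ,
        boundary_apply, Nat.cast_sum]
      refine Finset.sum_congr rfl fun e _ => ?_
      have h01 : ∀ a : ZMod 2, a = 0 ∨ a = 1 := by decide
      rcases h01 (ψ e) with h3 | h3 <;> by_cases h1 : t e = v <;> by_cases h2 : h e = v <;>
        simp [h1, h2, h3]
      rfl
    obtain ⟨r, hr⟩ := h2
    omega
  have hz : ∑ v, z v = 2 * (Finset.univ.filter fun e => ψ e ≠ 0).card := by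
    rw [Finset.sum_comm, Finset.card_filter, Finset.mul_sum]
    refine Finset.sum_congr rfl fun e _ => ?_
    split_ifs <;> simp [Finset.sum_add_distrib]
  have hw : ∑ v, w v + 2 * (Finset.univ.filter fun e => ψ e ≠ 0).card = 2 * Fintype.card E := by
    rw [Finset.sum_comm, Finset.card_filter, Finset.mul_sum, ← Finset.sum_add_distrib,
      ← Finset.card_univ, Finset.card_eq_sum_ones, Finset.mul_sum]
    refine Finset.sum_congr rfl fun e _ => ?_
    split_ifs <;> simp [Finset.sum_add_distrib]
  have hsum : ∑ _v : V, 7 ≤ ∑ v, (2 * z v + 3 * w v) := Finset.sum_le_sum fun v _ => hv v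
  rw [Finset.sum_const, Finset.card_univ, smul_eq_mul, Finset.sum_add_distrib, ← Finset.mul_sum,
    ← Finset.mul_sum] at hsum
  omega

/-- The `ZMod 2`-flows that agree with `ψ` off an edge set `Y` form a coset of the cycle space of
`Y`, whose dimension is at least `|Y| - |V|`. -/
theorem two_pow_le_card_flows [DecidableEq E] (ψ : E → ZMod 2) (hψ : boundary t h ψ = 0)
    (P : E → Prop) [DecidablePred P] (k : ℕ)
    (hk : Fintype.card V + (Finset.univ.filter P).card + k ≤ Fintype.card E) :
    2 ^ k ≤ (Finset.univ.filter fun ψ' : E → ZMod 2 =>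
      boundary t h ψ' = 0 ∧ ∀ e, P e → ψ' e = ψ e).card := by
  classical
  let Φ : (E → ZMod 2) → (V → ZMod 2) × ({e // P e} → ZMod 2) :=
    fun D => (boundary t h D, fun e => D e)
  obtain ⟨y, -, hy⟩ := Finset.exists_le_card_fiber_of_mul_le_card_of_maps_to (f := Φ)
    (s := Finset.univ) (t := Finset.univ) (n := 2 ^ k) (fun _ _ => Finset.mem_univ _)
    Finset.univ_nonempty (by
      simp only [Finset.card_univ, Fintype.card_prod, Fintype.card_pi, ZMod.card,
        Finset.prod_const, Fintype.card_subtype]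
      rw [← pow_add, ← pow_add]
      exact Nat.pow_le_pow_right (by norm_num) hk)
  obtain ⟨D₀, hD₀⟩ := Finset.card_pos.1 (lt_of_lt_of_le (by positivity) hy)
  refine hy.trans (Finset.card_le_card_of_injOn (fun D => ψ + (D - D₀)) ?_ ?_)
  · intro D hD
    have h1 : Φ D = Φ D₀ :=
      (Finset.mem_filter.1 hD).2.trans (Finset.mem_filter.1 hD₀).2.symm
    have h2 : boundary t h D = boundary t h D₀ := congrArg Prod.fst h1
    refine Finset.mem_filter.2 ⟨Finset.mem_univ _, ?_, fun e he => ?_⟩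
    · rw [map_add, map_sub, h2, hψ]
      simp
    · have h3 : D e = D₀ e := congrFun (congrArg Prod.snd h1) ⟨e, he⟩
      simp [h3]
  · intro D _ D' _ hDD
    simpa using hDD

/-- Some `ZMod 3`-flow extends in exponentially many ways to a nowhere-zero
`ZMod 2 × ZMod 3`-flow. -/
theorem exists_many_flow_pairs [DecidableEq E] [Nontrivial V]
    (hG : ∀ X : Finset V, X.Nonempty → X ≠ Finset.univ →
      3 ≤ (Finset.univ.filter fun e => (t e ∈ X ∧ h e ∉ X) ∨ (t e ∉ X ∧ h e ∈ X)).card) :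
    ∃ (φ : E → ZMod 3) (k : ℕ), boundary t h φ = 0 ∧ Fintype.card V ≤ 6 * k ∧
      2 ^ k ≤ (Finset.univ.filter fun ψ : E → ZMod 2 =>
        boundary t h ψ = 0 ∧ ∀ e, φ e = 0 → ψ e = 1).card := by
  classical
  obtain ⟨ψ, φ₀, hψ, hφ₀, hψφ₀⟩ := exists_flow_pair t h hG
  obtain ⟨φ, hφ, hψφ, hzero⟩ := exists_flow_few_zeros t h ψ hψ φ₀ hφ₀ hψφ₀
  have hdeg := seven_mul_card_le t h ψ hψ fun v => by
    have hne : ({v} : Finset V) ≠ Finset.univ := by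
      obtain ⟨w, hw⟩ := exists_ne v
      intro hv
      exact hw (Finset.mem_singleton.1 (hv ▸ Finset.mem_univ w))
    simpa only [Finset.mem_singleton] using hG {v} (Finset.singleton_nonempty v) hne
  refine ⟨φ, Fintype.card E - Fintype.card V - (Finset.univ.filter fun e => φ e = 0).card, hφ,
    by omega, ?_⟩
  refine (two_pow_le_card_flows t h ψ hψ (fun e => φ e = 0) _ (by omega)).trans
    (Finset.card_le_card fun ψ' hψ' => ?_)
  obtain ⟨-, h1, h2⟩ := Finset.mem_filter.1 hψ'
  refine Finset.mem_filter.2 ⟨Finset.mem_univ _, h1, fun e he => ?_⟩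
  have h01 : ∀ a : ZMod 2, a ≠ 0 → a = 1 := by decide
  rw [h2 e he]
  exact h01 _ fun h0 => hψφ e h0 he

end Counting

/-! ### Graphs -/

theorem mainTheorem1 {α β : Type*} (G : Graph α β)
    (hV : G.vertexSet.Finite) (hE : G.edgeSet.Finite) (hne : G.edgeSet.Nonempty)
    (hG : G.IsEdgeConnected 3) (D : G.Orientation) :
    (2 : ℝ) ^ ((G.vertexSet.ncard : ℝ) / 7) ≤
      ((D.nowhereZeroFlows (ZMod 2 × ZMod 3)).ncard : ℝ) := by
  classical
  let _ : Fintype G.vertexSet := hV.fintype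
  let _ : Fintype G.edgeSet := hE.fintype
  have hfin : (D.nowhereZeroFlows (ZMod 2 × ZMod 3)).Finite := Set.toFinite _
  let t : G.edgeSet → G.vertexSet := fun e => ⟨D.tail e, (D.isLink e).left_mem⟩
  let h : G.edgeSet → G.vertexSet := fun e => ⟨D.head e, (D.isLink e).right_mem⟩
  have hn : G.vertexSet.ncard = Fintype.card G.vertexSet := by
    rw [← Nat.card_eq_fintype_card, Nat.card_coe_set_eq]
  suffices hk : ∃ k : ℕ, Fintype.card G.vertexSet ≤ 7 * k ∧
      2 ^ k ≤ (D.nowhereZeroFlows (ZMod 2 × ZMod 3)).ncard by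
    obtain ⟨k, hk1, hk2⟩ := hk
    calc (2 : ℝ) ^ ((G.vertexSet.ncard : ℝ) / 7) ≤ 2 ^ (k : ℝ) := by
          refine Real.rpow_le_rpow_of_exponent_le (by norm_num) ?_
          rw [div_le_iff₀ (by norm_num), hn]
          exact_mod_cast (by omega : Fintype.card G.vertexSet ≤ k * 7)
      _ = 2 ^ k := Real.rpow_natCast _ _
      _ ≤ _ := by exact_mod_cast hk2
  rcases subsingleton_or_nontrivial G.vertexSet with hs | hs
  · -- All edges are loops, and the constants `(1, 0)` and `(0, 1)` are flows.
    have hconst : ∀ c : ZMod 2 × ZMod 3, c ≠ 0 →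
        (fun _ => c) ∈ D.nowhereZeroFlows (ZMod 2 × ZMod 3) := by
      refine fun c hc => ⟨fun v _ => ?_, fun _ => hc⟩
      have : D.outEdges v = D.inEdges v := by
        ext e
        have : D.tail e = D.head e := congrArg Subtype.val (Subsingleton.elim (t e) (h e))
        simp only [Graph.Orientation.outEdges, Graph.Orientation.inEdges, Set.mem_ofPred_eq, this]
      rw [this]
    obtain ⟨e, he⟩ := hne
    refine ⟨1, ?_, ?_⟩
    · have := Fintype.card_le_one_iff_subsingleton.2 hs
      omega
    · refine (Set.one_lt_ncard hfin).2 ⟨_, hconst (1, 0) (by decide), _,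
        hconst (0, 1) (by decide), fun heq => ?_⟩
      exact absurd (congrFun heq ⟨e, he⟩) (by decide)
  have hcut : ∀ X : Finset G.vertexSet, X.Nonempty → X ≠ Finset.univ →
      3 ≤ (Finset.univ.filter fun e => (t e ∈ X ∧ h e ∉ X) ∨ (t e ∉ X ∧ h e ∈ X)).card := by
    intro X hX hXne
    have hss : Subtype.val '' (X : Set G.vertexSet) ⊂ G.vertexSet := by
      refine ⟨by rintro _ ⟨v, -, rfl⟩; exact v.2, fun hsub => hXne ?_⟩
      refine Finset.eq_univ_iff_forall.2 fun v => ?_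
      obtain ⟨w, hw, hwv⟩ := hsub v.2
      exact Subtype.ext hwv ▸ hw
    have h3 := hG.2 _ hss (Set.Nonempty.image _ (Finset.coe_nonempty.2 hX))
    have hsub : G.cut (Subtype.val '' (X : Set G.vertexSet)) ⊆
        ((Finset.univ.filter fun e => (t e ∈ X ∧ h e ∉ X) ∨ (t e ∉ X ∧ h e ∈ X)).image
          Subtype.val : Finset β) := by
      rintro e ⟨_, ⟨x, hx, rfl⟩, y, ⟨hy, hyX⟩, hl⟩
      have hyX' : (⟨y, hy⟩ : G.vertexSet) ∉ X := fun hc => hyX ⟨_, hc, rfl⟩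
      refine Finset.mem_coe.2 (Finset.mem_image.2 ⟨⟨e, hl.edge_mem⟩, ?_, rfl⟩)
      refine Finset.mem_filter.2 ⟨Finset.mem_univ _, ?_⟩
      rcases hl.eq_and_eq_or_eq_and_eq (D.isLink ⟨e, hl.edge_mem⟩) with ⟨h1, h2⟩ | ⟨h1, h2⟩
      · have e1 : t ⟨e, hl.edge_mem⟩ = x := Subtype.ext h1.symm
        have e2 : h ⟨e, hl.edge_mem⟩ = ⟨y, hy⟩ := Subtype.ext h2.symm
        rw [e1, e2]
        exact Or.inl ⟨hx, hyX'⟩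
      · have e1 : h ⟨e, hl.edge_mem⟩ = x := Subtype.ext h1.symm
        have e2 : t ⟨e, hl.edge_mem⟩ = ⟨y, hy⟩ := Subtype.ext h2.symm
        rw [e1, e2]
        exact Or.inr ⟨hyX', hx⟩
    have h4 := h3.trans (Set.encard_le_encard hsub)
    rw [Set.encard_coe_eq_coe_finsetCard] at h4
    exact (by exact_mod_cast h4 : 3 ≤ _).trans Finset.card_image_le
  obtain ⟨φ, k, hφ, hk, hcard⟩ := exists_many_flow_pairs t h hcut
  refine ⟨k, by omega, hcard.trans ?_⟩
  rw [← Set.ncard_coe_finset]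
  refine Set.ncard_le_ncard_of_injOn (fun ψ e => (ψ e, φ e)) ?_ ?_ hfin
  · intro ψ hψ
    obtain ⟨-, hψb, hψφ⟩ := Finset.mem_filter.1 hψ
    refine ⟨fun v hv => ?_, fun e h0 => ?_⟩
    · have key : ∀ {A : Type} [CommRing A] (χ : G.edgeSet → A), boundary t h χ = 0 →
          ∑ e, (if D.tail e = v then χ e else 0) = ∑ e, if D.head e = v then χ e else 0 := by
        intro A _ χ hχ
        have hχv := congrFun hχ ⟨v, hv⟩
        rw [boundary_apply] at hχv
        rw [← sub_eq_zero, ← Finset.sum_sub_distrib]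
        simpa [t, h, Subtype.ext_iff, mul_sub] using hχv
      rw [finsum_mem_def, finsum_mem_def, finsum_eq_sum_of_fintype, finsum_eq_sum_of_fintype]
      simp only [Set.indicator_apply, Graph.Orientation.outEdges, Graph.Orientation.inEdges,
        Set.mem_ofPred_eq]
      refine Prod.ext ?_ ?_
      · simp only [Prod.fst_sum, apply_ite Prod.fst, Prod.fst_zero]
        exact key ψ hψb
      · simp only [Prod.snd_sum, apply_ite Prod.snd, Prod.snd_zero]
        exact key φ hφ
    · have h1 : ψ e = 0 := congrArg Prod.fst h0
      have h2 := hψφ e (congrArg Prod.snd h0)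
      rw [h1] at h2
      exact absurd h2 (by decide)
  · intro ψ _ ψ' _ heq
    funext e
    exact congrArg Prod.fst (congrFun heq e)
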